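/- For a finite simple graph $G=(V,E)$, a set $S\subseteq V$ is dominating if every vertex of $V\setminus S$ is adjacent to at least one vertex of $S$; $\gamma(G)$ is the minimum cardinality of a dominating set, $d(G,i)$ is the number of dominating sets of cardinality $i$, and the domination polynomial of $G$ is $D(G,x)=\sum_{i=\gamma(G)}^{|V|} d(G,i)\,x^i$. For $n\ge 1$ let $F_n$ be the friendship graph, obtained from $n$ triangles by identifying one vertex of each into a single common vertex, and let $F_n^c$ be its complement. For a family $(f_n)_{n\ge 1}$ of complex polynomials, $z\in\mathbb{C}$ is called a limit of roots of the family if either $f_n(z)=0$ for all sufficiently large $n$, or $z$ is a limit point (accumulation point) of the set of all roots of all the $f_n$, i.e. of $\bigcup_{n\ge 1}\{x\in\mathbb{C} : f_n(x)=0\}$. **Theorem.** The set of limits of roots of the family $\big(D(F_n^c,x)\big)_{n\ge 1}$ is exactly the circle $\{z\in\mathbb{C} : |z+1|=1\}$. -/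

import Mathlib

noncomputable section

namespace SimpleGraph

/-- `S` is a dominating set of `G`: every vertex outside `S` is adjacent to a vertex of `S`. -/
def IsDominatingSet {V : Type*} (G : SimpleGraph V) (S : Finset V) : Prop :=
  ∀ v, v ∉ S → ∃ u ∈ S, G.Adj v u

/-- The domination number: the minimum cardinality of a dominating set
(the whole vertex set is dominating, so the minimum is attained). -/
def dominationNumber {V : Type*} [Fintype V] (G : SimpleGraph V) : ℕ :=
  sInf {i : ℕ | ∃ S : Finset V, G.IsDominatingSet S ∧ S.card = i}

open scoped Classical in
/-- The number of dominating sets of `G` of cardinality `i`. -/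
def numDominatingSets {V : Type*} [Fintype V] (G : SimpleGraph V) (i : ℕ) : ℕ :=
  (Finset.univ.filter fun S : Finset V => G.IsDominatingSet S ∧ S.card = i).card

/-- The domination polynomial, as a polynomial with complex coefficients. -/
def dominationPolynomial {V : Type*} [Fintype V] (G : SimpleGraph V) : Polynomial ℂ :=
  ∑ i ∈ Finset.Icc G.dominationNumber (Fintype.card V),
    Polynomial.C (G.numDominatingSets i : ℂ) * Polynomial.X ^ i

/-- The friendship graph `F_n`: `n` triangles glued at one common vertex. The common vertex is
`none`, and the other two vertices of the `k`-th triangle are `some (k, 0)` and `some (k, 1)`. -/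
def friendshipGraph (n : ℕ) : SimpleGraph (Option (Fin n × Fin 2)) :=
  SimpleGraph.fromRel fun u v => ∃ k : Fin n,
    (u = none ∨ u = some (k, 0) ∨ u = some (k, 1)) ∧
    (v = none ∨ v = some (k, 0) ∨ v = some (k, 1))

end SimpleGraph

/-- `z` is a limit of roots of the family `f 1, f 2, …`: either `f n` vanishes at `z` for all
sufficiently large `n`, or `z` is a limit point (accumulation point) of the union of the root
sets of all the `f n`. -/
def IsLimitOfRoots (f : ℕ+ → Polynomial ℂ) (z : ℂ) : Prop :=
  (∀ᶠ n in Filter.atTop, (f n).IsRoot z) ∨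
    AccPt z (Filter.principal (⋃ n, {x : ℂ | (f n).IsRoot x}))

end

open Filter Topology

/-! ### Domination in the complement of the friendship graph -/

namespace SimpleGraph

/-! In `F_n^c` the common vertex is isolated and the other vertices form a complete multipartite
graph with parts of size 2. Counting gives `D(F_n^c, x) = x((1+x)^(2n) - 2nx - 1)`, so with `w = x +
1` and `m = 2n` the roots are the solutions of `w^m - 1 = m(w - 1)`.

In the closed unit disc only `w = 1` solves this (`eq_one_of_pow_sub_one_eq_mul`). On bounded sets
with `‖w‖ ≥ r > 1`, exponential growth beats linear growth for large `m`. Hence limits lie on the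
circle. Conversely, a contraction argument gives solutions near every `exp(iθ) ≠ 1`
(`eventually_exists_pow_eq`), while `w = 1`, i.e. `x = 0`, is always a root. -/

theorem not_friendshipGraph_compl_adj_none (n : ℕ) (u : Option (Fin n × Fin 2)) :
    ¬ (friendshipGraph n)ᶜ.Adj none u := by
  rintro ⟨hne, h⟩
  apply h
  rcases u with _ | ⟨k, a⟩
  · exact absurd rfl hne
  · refine ⟨hne, Or.inl ⟨k, Or.inl rfl, Or.inr ?_⟩⟩
    fin_cases a <;> simp

theorem friendshipGraph_compl_adj_some (n : ℕ) (p q : Fin n × Fin 2) :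
    (friendshipGraph n)ᶜ.Adj (some p) (some q) ↔ p.1 ≠ q.1 := by
  obtain ⟨k, a⟩ := p
  obtain ⟨l, b⟩ := q
  fin_cases a <;> fin_cases b <;>
    simp [friendshipGraph, compl_adj, fromRel_adj] <;> grind

/-- Two vertices other than the common one either lie in different parts, so that every vertex
misses the part of one of them, or fill a whole part, which dominates the rest. -/
theorem isDominatingSet_friendshipGraph_compl {n : ℕ} (hn : 1 ≤ n)
    (S : Finset (Option (Fin n × Fin 2))) :
    (friendshipGraph n)ᶜ.IsDominatingSet S ↔ none ∈ S ∧ 2 ≤ S.eraseNone.card := by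
  constructor
  · intro h
    refine ⟨?_, ?_⟩
    · by_contra hS
      obtain ⟨u, _, hu⟩ := h none hS
      exact not_friendshipGraph_compl_adj_none n u hu
    · by_contra! hc
      -- If one vertex remains, its undominated partner is the other vertex of the same triangle, `a
      -- + 1` being taken in `Fin 2`.
      have key : ∃ v : Fin n × Fin 2, v ∉ S.eraseNone ∧ ∀ p ∈ S.eraseNone, v.1 = p.1 := by
        rcases S.eraseNone.eq_empty_or_nonempty with h0 | h0
        · exact ⟨(⟨0, hn⟩, 0), by simp [h0]⟩
        · have h1 : S.eraseNone.card = 1 := by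
            have := h0.card_pos
            omega
          obtain ⟨⟨k, a⟩, hp⟩ := Finset.card_eq_one.mp h1
          refine ⟨(k, a + 1), ?_, ?_⟩
          · rw [hp]
            fin_cases a <;> simp
          · rw [hp]
            simp
      obtain ⟨v, hv, hv'⟩ := key
      obtain ⟨u, hu, hadj⟩ := h (some v) (by simpa using hv)
      rcases u with _ | p
      · exact not_friendshipGraph_compl_adj_none n _ hadj.symm
      · exact (friendshipGraph_compl_adj_some n v p).mp hadj (hv' p (by simpa using hu))
  · rintro ⟨h0, h2⟩ v hv
    rcases v with _ | ⟨k, a⟩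
    · exact absurd h0 hv
    · obtain ⟨⟨l, b⟩, hp, ⟨l', c⟩, hq, hne⟩ := Finset.one_lt_card.mp h2
      rw [Finset.mem_eraseNone] at hp hq
      by_cases hl : k = l
      · refine ⟨_, hq, (friendshipGraph_compl_adj_some n _ _).mpr ?_⟩
        rintro rfl
        subst hl
        have hab : a ≠ b := by rintro rfl; exact hv hp
        have hac : a ≠ c := by rintro rfl; exact hv hq
        have hbc : b ≠ c := by rintro rfl; exact hne rfl
        omega
      · exact ⟨_, hp, (friendshipGraph_compl_adj_some n _ _).mpr hl⟩

theorem numDominatingSets_friendshipGraph_compl_zero {n : ℕ} (hn : 1 ≤ n) :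
    (friendshipGraph n)ᶜ.numDominatingSets 0 = 0 := by
  classical
  rw [numDominatingSets, Finset.card_eq_zero, Finset.filter_eq_empty_iff]
  rintro S - ⟨hS, h0⟩
  rw [Finset.card_eq_zero.mp h0, isDominatingSet_friendshipGraph_compl hn] at hS
  simp at hS

theorem numDominatingSets_friendshipGraph_compl_succ {n : ℕ} (hn : 1 ≤ n) (i : ℕ) :
    (friendshipGraph n)ᶜ.numDominatingSets (i + 1) = if 2 ≤ i then (2 * n).choose i else 0 := by
  classical
  have key : (friendshipGraph n)ᶜ.numDominatingSets (i + 1) =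
      (Finset.univ.filter fun T : Finset (Fin n × Fin 2) => 2 ≤ T.card ∧ T.card = i).card := by
    rw [numDominatingSets]
    symm
    refine Finset.card_nbij' (fun T => T.insertNone) (fun S => S.eraseNone) ?_ ?_ ?_ ?_
    · intro T hT
      simp only [Finset.coe_filter, Finset.mem_univ, true_and, Set.mem_ofPred_eq] at hT ⊢
      rw [isDominatingSet_friendshipGraph_compl hn]
      exact ⟨⟨by simp, by simpa using hT.1⟩, by simp [hT.2]⟩
    · intro S hS
      simp only [Finset.coe_filter, Finset.mem_univ, true_and, Set.mem_ofPred_eq] at hS ⊢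
      rw [isDominatingSet_friendshipGraph_compl hn] at hS
      refine ⟨hS.1.2, ?_⟩
      have h := congrArg Finset.card (Finset.insertNone_eraseNone S)
      rw [Finset.card_insertNone, Finset.insert_eq_of_mem hS.1.1] at h
      omega
    · intro T _
      simp
    · intro S hS
      simp only [Finset.coe_filter, Finset.mem_univ, true_and, Set.mem_ofPred_eq] at hS ⊢
      rw [isDominatingSet_friendshipGraph_compl hn] at hS
      rw [Finset.insertNone_eraseNone, Finset.insert_eq_of_mem hS.1.1]
  rw [key]
  split_ifs with hi
  · have : (Finset.univ.filter fun T : Finset (Fin n × Fin 2) => 2 ≤ T.card ∧ T.card = i) =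
        Finset.univ.powersetCard i := by
      ext T
      simp only [Finset.mem_filter, Finset.mem_univ, true_and, Finset.mem_powersetCard,
        Finset.subset_univ]
      omega
    rw [this, Finset.card_powersetCard]
    simp [mul_comm]
  · rw [Finset.card_eq_zero, Finset.filter_eq_empty_iff]
    intro T _
    omega

theorem numDominatingSets_eq_zero_of_lt {V : Type*} [Fintype V] (G : SimpleGraph V) {i : ℕ}
    (hi : i < G.dominationNumber) : G.numDominatingSets i = 0 := by
  classical
  rw [numDominatingSets, Finset.card_eq_zero, Finset.filter_eq_empty_iff]
  intro S _ hS
  exact hi.not_ge (Nat.sInf_le ⟨S, hS⟩)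

/-- Summing from 0 makes it unnecessary to compute the domination number. -/
theorem eval_dominationPolynomial {V : Type*} [Fintype V] (G : SimpleGraph V) (x : ℂ) :
    G.dominationPolynomial.eval x =
      ∑ i ∈ Finset.range (Fintype.card V + 1), (G.numDominatingSets i : ℂ) * x ^ i := by
  rw [dominationPolynomial, Polynomial.eval_finsetSum]
  simp only [Polynomial.eval_mul, Polynomial.eval_C, Polynomial.eval_pow, Polynomial.eval_X]
  refine Finset.sum_subset (fun i hi => ?_) (fun i hi hi' => ?_)
  · simp only [Finset.mem_Icc, Finset.mem_range] at hi ⊢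
    omega
  · simp only [Finset.mem_Icc, Finset.mem_range] at hi hi'
    rw [numDominatingSets_eq_zero_of_lt G (by omega)]
    simp

theorem eval_dominationPolynomial_friendshipGraph_compl {n : ℕ} (hn : 1 ≤ n) (x : ℂ) :
    (friendshipGraph n)ᶜ.dominationPolynomial.eval x =
      x * ((1 + x) ^ (2 * n) - 2 * n * x - 1) := by
  have hcard : Fintype.card (Option (Fin n × Fin 2)) = 2 * n + 1 := by
    simp [mul_comm]
  -- The two lowest binomial terms, `1` and `2nx`, are the ones missing from the count, so both are
  -- split off.
  obtain ⟨m, hm⟩ : ∃ m, 2 * n + 1 = m + 1 + 1 := ⟨2 * n - 1, by omega⟩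
  rw [eval_dominationPolynomial, hcard, Finset.sum_range_succ',
    numDominatingSets_friendshipGraph_compl_zero hn, add_comm (1 : ℂ) x, add_pow, hm]
  simp only [numDominatingSets_friendshipGraph_compl_succ hn]
  rw [Finset.sum_range_succ', Finset.sum_range_succ',
    Finset.sum_range_succ' _ (m + 1), Finset.sum_range_succ' _ m]
  have h2 (k : ℕ) : 2 ≤ k + 1 + 1 := by omega
  simp only [h2, if_true]
  simp only [one_pow, mul_one, zero_add, Nat.choose_one_right, Nat.choose_zero_right, pow_zero,
    pow_one]
  have hs : ∑ k ∈ Finset.range m, ((2 * n).choose (k + 1 + 1) : ℂ) * x ^ (k + 1 + 1 + 1) =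
      x * ∑ k ∈ Finset.range m, x ^ (k + 1 + 1) * ((2 * n).choose (k + 1 + 1) : ℂ) := by
    rw [Finset.mul_sum]
    exact Finset.sum_congr rfl fun k _ => by ring
  rw [hs]
  push_cast
  norm_num
  left
  ring

end SimpleGraph

/-! ### The equation `w^m - 1 = m(w - 1)` -/

/-- Dividing by `w - 1` leaves `1 + w + ... + w^(m-1) = m`. Each term has real part at most 1, and
the term `w` has real part strictly below 1 unless `w = 1`. -/
theorem eq_one_of_pow_sub_one_eq_mul {w : ℂ} (hw : ‖w‖ ≤ 1) {m : ℕ} (hm : 2 ≤ m)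
    (h : w ^ m - 1 = m * (w - 1)) : w = 1 := by
  by_contra hne
  have hsum : ∑ i ∈ Finset.range m, w ^ i = m := by
    have := geom_sum_mul w m
    rw [h] at this
    exact mul_right_cancel₀ (sub_ne_zero.mpr hne) this
  have hle (i : ℕ) : (w ^ i).re ≤ 1 :=
    (Complex.re_le_norm _).trans (by rw [norm_pow]; exact pow_le_one₀ (norm_nonneg _) hw)
  have hlt : w.re < 1 := by
    refine lt_of_le_of_ne (by simpa using hle 1) fun hre => hne ?_
    have h1 := Complex.sq_norm w
    rw [Complex.normSq_apply, hre] at h1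
    have h2 : ‖w‖ ^ 2 ≤ 1 := pow_le_one₀ (norm_nonneg _) hw
    have h3 : w.im = 0 := by nlinarith [mul_self_nonneg w.im]
    exact Complex.ext hre h3
  have hre := congrArg Complex.re hsum
  rw [Complex.re_sum, Complex.natCast_re] at hre
  have : ∑ i ∈ Finset.range m, (w ^ i).re < ∑ i ∈ Finset.range m, (1 : ℝ) :=
    Finset.sum_lt_sum (fun i _ => hle i) ⟨1, by simp; omega, by simpa using hlt⟩
  simp at this
  linarith

theorem eventually_pow_gt_of_one_lt {r : ℝ} (hr : 1 < r) (R : ℝ) :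
    ∀ᶠ m : ℕ in atTop, (m : ℝ) * R + 1 < r ^ m := by
  have h1 := tendsto_pow_const_div_const_pow_of_one_lt 1 hr
  have h0 := tendsto_pow_const_div_const_pow_of_one_lt 0 hr
  have h2 : Tendsto (fun m : ℕ => (m : ℝ) ^ 1 / r ^ m * R + (m : ℝ) ^ 0 / r ^ m) atTop (𝓝 0) := by
    simpa using (h1.mul_const R).add h0
  filter_upwards [h2.eventually_lt_const one_pos] with m hm
  have hpos : 0 < r ^ m := by positivity
  rw [pow_one, pow_zero, div_mul_eq_mul_div, ← add_div, div_lt_one hpos] at hm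
  exact hm

/-- The equation `w ^ m = 1 + m (w - 1)` has, for large `m`, a solution near any point of the unit
circle other than `1`. -/
theorem eventually_exists_pow_eq {θ : ℝ} (hθ : Complex.exp (θ * Complex.I) ≠ 1) {ε : ℝ}
    (hε : 0 < ε) : ∀ᶠ m : ℕ in atTop, ∃ w : ℂ, ‖w - Complex.exp (θ * Complex.I)‖ < ε ∧
      w ^ m - 1 = m * (w - 1) := by
  set s₀ : ℂ := θ * Complex.I with hs₀
  have hnorm : ‖Complex.exp s₀‖ = 1 := Complex.norm_exp_ofReal_mul_I θ
  have hre : (Complex.exp s₀).re < 1 := by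
    refine lt_of_le_of_ne (hnorm ▸ Complex.re_le_norm _) fun h => hθ ?_
    have h1 := Complex.sq_norm (Complex.exp s₀)
    rw [Complex.normSq_apply, h, hnorm] at h1
    have h3 : (Complex.exp s₀).im = 0 := by nlinarith [mul_self_nonneg (Complex.exp s₀).im]
    exact Complex.ext h h3
  -- The margin `2δ` leaves `Re(1 - exp s - 1/m) > δ` near `s₀` once `1/m < δ`: the logarithm is
  -- then holomorphic and its derivative bounded by `2/δ`.
  obtain ⟨δ, hδ, hδ'⟩ : ∃ δ > 0, (Complex.exp s₀).re + 2 * δ < 1 :=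
    ⟨(1 - (Complex.exp s₀).re) / 4, by linarith, by linarith⟩
  have hev : ∀ᶠ s in 𝓝 s₀, (Complex.exp s).re + 2 * δ < 1 ∧ ‖Complex.exp s‖ < 2 ∧
      ‖Complex.exp s - Complex.exp s₀‖ < ε := by
    have hc : ContinuousAt Complex.exp s₀ := Complex.continuous_exp.continuousAt
    have hcre := Complex.continuous_re.continuousAt.comp hc
    refine (((hcre.add continuousAt_const).eventually_lt continuousAt_const hδ').and
      ((hc.norm.eventually_lt continuousAt_const ?_).and
        ((hc.sub continuousAt_const).norm.eventually_lt continuousAt_const ?_)))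
    · rw [hnorm]; norm_num
    · simpa using hε
  obtain ⟨r, hr, hball⟩ := Metric.nhds_basis_closedBall.eventually_iff.mp hev
  -- With `w = exp s` the equation reads `exp(ms) = -m(1 - exp s - 1/m)`. Taking logarithms, a fixed
  -- point of `g m` gives a solution; `πi` accounts for the sign, and the branch `k m` is chosen so
  -- that `2π(k m)/m → θ`.
  let k (m : ℕ) : ℤ := ⌊(m : ℝ) * (θ / (2 * Real.pi))⌋
  let L (m : ℕ) (s : ℂ) : ℂ := Complex.log (1 - Complex.exp s - (m : ℂ)⁻¹)
  let c (m : ℕ) : ℂ := (Real.log m : ℂ) + Real.pi * Complex.I + k m * (2 * Real.pi * Complex.I)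
  let g (m : ℕ) (s : ℂ) : ℂ := (m : ℂ)⁻¹ * (c m + L m s)
  have hinv : Tendsto (fun m : ℕ => ((m : ℂ))⁻¹) atTop (𝓝 0) :=
    tendsto_inv_atTop_nhds_zero_nat (𝕜 := ℂ)
  have hinvR : Tendsto (fun m : ℕ => ((m : ℝ))⁻¹) atTop (𝓝 0) :=
    tendsto_inv_atTop_nhds_zero_nat (𝕜 := ℝ)
  have hcenter : Tendsto (fun m => g m s₀) atTop (𝓝 s₀) := by
    have hL : Tendsto (fun m => L m s₀) atTop (𝓝 (Complex.log (1 - Complex.exp s₀ - 0))) := by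
      refine Tendsto.clog (tendsto_const_nhds.sub hinv) (Or.inl ?_)
      simp
      linarith
    have hlog : Tendsto (fun m : ℕ => (m : ℂ)⁻¹ * (Real.log m : ℂ)) atTop (𝓝 0) := by
      have h1 : Tendsto (fun m : ℕ => Real.log m / (m : ℝ)) atTop (𝓝 0) :=
        (Real.isLittleO_log_id_atTop.tendsto_div_nhds_zero).comp tendsto_natCast_atTop_atTop
      have h2 := (Complex.continuous_ofReal.tendsto 0).comp h1
      simp only [Complex.ofReal_zero] at h2
      refine h2.congr fun m => ?_
      simp [div_eq_inv_mul]
    have hk : Tendsto (fun m : ℕ => (m : ℂ)⁻¹ * (k m : ℂ)) atTop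
        (𝓝 ((θ / (2 * Real.pi) : ℝ) : ℂ)) := by
      have h1 : Tendsto (fun m : ℕ => (⌊(m : ℝ) * (θ / (2 * Real.pi))⌋ : ℝ) / (m : ℝ)) atTop
          (𝓝 (θ / (2 * Real.pi))) := by
        have h3 : Tendsto (fun m : ℕ => θ / (2 * Real.pi) - (m : ℝ)⁻¹) atTop
            (𝓝 (θ / (2 * Real.pi))) := by
          simpa using (tendsto_const_nhds (x := θ / (2 * Real.pi))).sub hinvR
        refine tendsto_of_tendsto_of_tendsto_of_le_of_le' h3 tendsto_const_nhds ?_ ?_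
        · filter_upwards [eventually_gt_atTop 0] with m hm
          have hm' : (0 : ℝ) < m := by exact_mod_cast hm
          rw [le_div_iff₀ hm', sub_mul, inv_mul_cancel₀ hm'.ne', mul_comm]
          linarith [Int.lt_floor_add_one ((m : ℝ) * (θ / (2 * Real.pi)))]
        · filter_upwards [eventually_gt_atTop 0] with m hm
          have hm' : (0 : ℝ) < m := by exact_mod_cast hm
          rw [div_le_iff₀ hm', mul_comm _ (m : ℝ)]
          exact Int.floor_le _
      have h2 := (Complex.continuous_ofReal.tendsto _).comp h1
      refine h2.congr fun m => ?_
      simp [k, div_eq_inv_mul]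
    have hsum := ((hlog.add (hinv.mul_const (Real.pi * Complex.I))).add
      (hk.mul_const (2 * Real.pi * Complex.I))).add (hinv.mul hL)
    have hval : (0 : ℂ) + 0 * (Real.pi * Complex.I) +
        ((θ / (2 * Real.pi) : ℝ) : ℂ) * (2 * Real.pi * Complex.I) +
        0 * Complex.log (1 - Complex.exp s₀ - 0) = s₀ := by
      have : (Real.pi : ℂ) ≠ 0 := by exact_mod_cast Real.pi_ne_zero
      rw [hs₀]
      push_cast
      field_simp
      ring
    rw [hval] at hsum
    refine hsum.congr fun m => ?_
    simp only [g, c]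
    ring
  have hK : Tendsto (fun m : ℕ => (m : ℝ)⁻¹ * (2 / δ)) atTop (𝓝 0) := by
    simpa using hinvR.mul_const (2 / δ)
  filter_upwards [eventually_gt_atTop 0, hinvR.eventually_lt_const hδ,
    hK.eventually_lt_const (show (0 : ℝ) < 1 / 2 by norm_num),
    (tendsto_iff_norm_sub_tendsto_zero.mp hcenter).eventually_lt_const (half_pos hr)]
    with m hm0 hmδ hmK hmc
  have hmC : (m : ℂ) ≠ 0 := by exact_mod_cast hm0.ne'
  have hrepos : ∀ s ∈ Metric.closedBall s₀ r, δ < (1 - Complex.exp s - (m : ℂ)⁻¹).re := by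
    intro s hs
    have h1 := (hball hs).1
    have h2 : ((m : ℂ)⁻¹).re = (m : ℝ)⁻¹ := by
      rw [← Complex.ofReal_natCast, ← Complex.ofReal_inv, Complex.ofReal_re]
    simp only [Complex.sub_re, Complex.one_re, h2]
    linarith
  have hderiv : ∀ s ∈ Metric.closedBall s₀ r, HasDerivWithinAt (g m)
      ((m : ℂ)⁻¹ * (-Complex.exp s / (1 - Complex.exp s - (m : ℂ)⁻¹)))
      (Metric.closedBall s₀ r) s := by
    intro s hs
    have h1 : HasDerivAt (fun s => 1 - Complex.exp s - (m : ℂ)⁻¹) (-Complex.exp s) s := by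
      simpa using ((Complex.hasDerivAt_exp s).const_sub 1).sub_const ((m : ℂ)⁻¹)
    have h2 := h1.clog (Or.inl (hδ.trans (hrepos s hs)))
    exact ((h2.const_add (c m)).const_mul ((m : ℂ)⁻¹)).hasDerivWithinAt
  have hbound : ∀ s ∈ Metric.closedBall s₀ r,
      ‖(m : ℂ)⁻¹ * (-Complex.exp s / (1 - Complex.exp s - (m : ℂ)⁻¹))‖ ≤ 1 / 2 := by
    intro s hs
    refine le_trans ?_ hmK.le
    rw [norm_mul, norm_div, norm_neg, norm_inv, Complex.norm_natCast]
    gcongr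
    · exact (hball hs).2.1.le
    · exact (hrepos s hs).le.trans (Complex.re_le_norm _)
  have hlip : ∀ x ∈ Metric.closedBall s₀ r, ∀ y ∈ Metric.closedBall s₀ r,
      ‖g m y - g m x‖ ≤ 1 / 2 * ‖y - x‖ := fun x hx y hy =>
    (convex_closedBall s₀ r).norm_image_sub_le_of_norm_hasDerivWithin_le hderiv hbound hx hy
  -- The map halves distances and moves the centre by less than `r/2`, so it preserves the ball.
  have hmaps : Set.MapsTo (g m) (Metric.closedBall s₀ r) (Metric.closedBall s₀ r) := by
    intro s hs
    have h1 := hlip s₀ (Metric.mem_closedBall_self hr.le) s hs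
    have h2 : ‖s - s₀‖ ≤ r := by simpa [dist_eq_norm] using hs
    rw [Metric.mem_closedBall, dist_eq_norm]
    calc ‖g m s - s₀‖ ≤ ‖g m s - g m s₀‖ + ‖g m s₀ - s₀‖ := norm_sub_le_norm_sub_add_norm_sub _ _ _
      _ ≤ r := by linarith
  have hcontr : ContractingWith (1 / 2) (hmaps.restrict (g m) _ _) := by
    refine ⟨by rw [← NNReal.coe_lt_coe]; norm_num, LipschitzWith.of_dist_le_mul fun x y => ?_⟩
    rw [Subtype.dist_eq, Subtype.dist_eq, dist_eq_norm, dist_eq_norm]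
    simpa using hlip y y.2 x x.2
  obtain ⟨s, hs, hfix, -⟩ := hcontr.exists_fixedPoint' Metric.isClosed_closedBall.isComplete hmaps
    (Metric.mem_closedBall_self hr.le) (edist_ne_top _ _)
  refine ⟨Complex.exp s, (hball hs).2.2, ?_⟩
  have hms : (m : ℂ) * s = c m + L m s := by
    conv_lhs => rw [← hfix.eq]
    simp only [g]
    rw [mul_inv_cancel_left₀ hmC]
  have hne : 1 - Complex.exp s - (m : ℂ)⁻¹ ≠ 0 := fun h => by
    have := hrepos s hs
    rw [h, Complex.zero_re] at this
    linarith
  have hlogm : Complex.exp (Real.log m : ℂ) = m := by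
    rw [← Complex.ofReal_exp, Real.exp_log (by exact_mod_cast hm0), Complex.ofReal_natCast]
  rw [← Complex.exp_nat_mul, hms]
  simp only [c, L]
  rw [Complex.exp_add, Complex.exp_add, Complex.exp_add, hlogm, Complex.exp_pi_mul_I,
    Complex.exp_int_mul_two_pi_mul_I, Complex.exp_log hne]
  field_simp
  ring

/-! ### Limits of roots -/

/-- The factor `x` adds no root, since `x = 0` already solves the equation. -/
theorem isRoot_dominationPolynomial_friendshipGraph_compl_iff (n : ℕ+) (x : ℂ) :
    (SimpleGraph.friendshipGraph (n : ℕ))ᶜ.dominationPolynomial.IsRoot x ↔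
      (x + 1) ^ (2 * (n : ℕ)) - 1 = ((2 * (n : ℕ) : ℕ) : ℂ) * (x + 1 - 1) := by
  rw [Polynomial.IsRoot.def,
    SimpleGraph.eval_dominationPolynomial_friendshipGraph_compl (Nat.succ_le_of_lt n.pos), add_comm 1 x]
  push_cast
  constructor
  · intro h
    rcases mul_eq_zero.mp h with rfl | h
    · simp
    · linear_combination h
  · intro h
    linear_combination x * h

theorem eventually_not_isRoot_of_one_lt {r R : ℝ} (hr : 1 < r) :
    ∀ᶠ n : ℕ+ in atTop, ∀ x : ℂ, r ≤ ‖x + 1‖ → ‖x‖ ≤ R →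
      ¬ (SimpleGraph.friendshipGraph (n : ℕ))ᶜ.dominationPolynomial.IsRoot x := by
  have h2 : Tendsto (fun n : ℕ+ => 2 * (n : ℕ)) atTop atTop :=
    tendsto_atTop_mono (fun n => by omega) tendsto_PNat_val_atTop_atTop
  filter_upwards [h2.eventually (eventually_pow_gt_of_one_lt hr R)] with n hn x hx hR hroot
  rw [isRoot_dominationPolynomial_friendshipGraph_compl_iff] at hroot
  have h3 : (x + 1) ^ (2 * (n : ℕ)) = ((2 * (n : ℕ) : ℕ) : ℂ) * x + 1 := by
    linear_combination hroot
  have h4 : r ^ (2 * (n : ℕ)) ≤ ((2 * (n : ℕ) : ℕ) : ℝ) * R + 1 :=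
    calc r ^ (2 * (n : ℕ)) ≤ ‖x + 1‖ ^ (2 * (n : ℕ)) := by gcongr
      _ = ‖((2 * (n : ℕ) : ℕ) : ℂ) * x + 1‖ := by rw [← norm_pow, h3]
      _ ≤ ‖((2 * (n : ℕ) : ℕ) : ℂ) * x‖ + ‖(1 : ℂ)‖ := norm_add_le _ _
      _ ≤ _ := by
        rw [norm_mul, Complex.norm_natCast, norm_one]
        gcongr
  exact absurd hn h4.not_gt

theorem dominationPolynomial_friendshipGraph_compl_ne_zero (n : ℕ+) :
    (SimpleGraph.friendshipGraph (n : ℕ))ᶜ.dominationPolynomial ≠ 0 := by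
  intro h
  have h1 : (SimpleGraph.friendshipGraph (n : ℕ))ᶜ.dominationPolynomial.IsRoot (-1) := by
    simp [h]
  rw [isRoot_dominationPolynomial_friendshipGraph_compl_iff] at h1
  have := eq_one_of_pow_sub_one_eq_mul (by simp) (by have := n.pos; omega) h1
  simp at this

theorem norm_eq_one_of_isLimitOfRoots {z : ℂ} (hz : IsLimitOfRoots
    (fun n : ℕ+ => (SimpleGraph.friendshipGraph (n : ℕ))ᶜ.dominationPolynomial) z) :
    ‖z + 1‖ = 1 := by
  have hsmall {x : ℂ} (hx : ‖x + 1‖ ≤ 1) {n : ℕ+}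
      (h : (SimpleGraph.friendshipGraph (n : ℕ))ᶜ.dominationPolynomial.IsRoot x) : x = 0 := by
    rw [isRoot_dominationPolynomial_friendshipGraph_compl_iff] at h
    simpa using eq_one_of_pow_sub_one_eq_mul hx (by have := n.pos; omega) h
  rcases lt_trichotomy ‖z + 1‖ 1 with hlt | heq | hgt
  · exfalso
    have hne0 : z ≠ 0 := by rintro rfl; simp at hlt
    rcases hz with hz | hz
    · obtain ⟨n, hn⟩ := hz.exists
      exact hne0 (hsmall hlt.le hn)
    · rw [accPt_iff_frequently] at hz
      have h1 : ∀ᶠ y in 𝓝 z, ‖y + 1‖ < 1 :=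
        ContinuousAt.eventually_lt (by fun_prop) continuousAt_const hlt
      obtain ⟨y, ⟨-, hy⟩, hy1, hy0⟩ := (hz.and_eventually (h1.and (eventually_ne_nhds hne0))).exists
      obtain ⟨n, hn⟩ := Set.mem_iUnion.mp hy
      exact hy0 (hsmall hy1.le hn)
  · exact heq
  · exfalso
    obtain ⟨r, hr, hrz⟩ := exists_between hgt
    have hev := eventually_not_isRoot_of_one_lt (R := ‖z‖ + 1) hr
    rcases hz with hz | hz
    · obtain ⟨n, hn, hn'⟩ := (hz.and hev).exists
      exact hn' z hrz.le (by linarith) hn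
    · obtain ⟨N, hN⟩ := eventually_atTop.mp hev
      -- The finitely many early polynomials have finitely many roots, so away from `z` itself these
      -- avoid a neighbourhood of `z`.
      have hfin : (⋃ n ∈ Set.Iio N, {x : ℂ |
          (SimpleGraph.friendshipGraph (n : ℕ))ᶜ.dominationPolynomial.IsRoot x}).Finite :=
        (Set.finite_Iio N).biUnion fun n _ =>
          Polynomial.finite_setOfPred_isRoot (dominationPolynomial_friendshipGraph_compl_ne_zero n)
      rw [accPt_iff_frequently] at hz
      have h1 : ∀ᶠ y in 𝓝 z, r < ‖y + 1‖ :=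
        ContinuousAt.eventually_lt continuousAt_const (by fun_prop) hrz
      have h2 : ∀ᶠ y in 𝓝 z, ‖y‖ < ‖z‖ + 1 :=
        ContinuousAt.eventually_lt (by fun_prop) continuousAt_const (by linarith)
      have h3 := (hfin.subset Set.sdiff_subset).isClosed.isOpen_compl.eventually_mem
        (x := z) (s := (_ \ {z})ᶜ) (by simp)
      obtain ⟨y, ⟨hyz, hy⟩, hy1, hy2, hy3⟩ := (hz.and_eventually (h1.and (h2.and h3))).exists
      obtain ⟨n, hn⟩ := Set.mem_iUnion.mp hy
      by_cases hnN : n < N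
      · exact hy3 ⟨Set.mem_biUnion hnN hn, hyz⟩
      · exact hN n (not_lt.mp hnN) y hy1.le hy2.le hn

theorem isLimitOfRoots_of_norm_eq_one {z : ℂ} (hz : ‖z + 1‖ = 1) : IsLimitOfRoots
    (fun n : ℕ+ => (SimpleGraph.friendshipGraph (n : ℕ))ᶜ.dominationPolynomial) z := by
  by_cases h0 : z = 0
  · left
    refine Eventually.of_forall fun n => ?_
    simp only [isRoot_dominationPolynomial_friendshipGraph_compl_iff, h0]
    simp
  · right
    have hexp : Complex.exp (Complex.arg (z + 1) * Complex.I) = z + 1 := by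
      simpa [hz] using Complex.norm_mul_exp_arg_mul_I (z + 1)
    rw [accPt_iff_nhds]
    intro U hU
    obtain ⟨ε, hε, hεU⟩ := Metric.mem_nhds_iff.mp (inter_mem hU (isOpen_ne.mem_nhds h0))
    have hev := eventually_exists_pow_eq (θ := Complex.arg (z + 1)) (by rw [hexp]; simpa using h0) hε
    have h2 : Tendsto (fun n : ℕ+ => 2 * (n : ℕ)) atTop atTop :=
      tendsto_atTop_mono (fun n => by omega) tendsto_PNat_val_atTop_atTop
    obtain ⟨n, w, hw, hroot⟩ := (h2.eventually hev).exists
    rw [hexp] at hw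
    have hmem : w - 1 ∈ Metric.ball z ε := by
      rw [Metric.mem_ball, dist_eq_norm]
      rwa [sub_sub, add_comm 1 z]
    refine ⟨w - 1, ⟨(hεU hmem).1, Set.mem_iUnion.mpr ⟨n, ?_⟩⟩, ?_⟩
    · rw [Set.mem_ofPred_eq, isRoot_dominationPolynomial_friendshipGraph_compl_iff]
      simpa using hroot
    -- The root differs from `z`, because on the unit circle only `w = 1` solves the equation.
    · intro hwz
      have hwz' : w = z + 1 := by linear_combination hwz
      have := eq_one_of_pow_sub_one_eq_mul (hwz' ▸ hz.le) (by have := n.pos; omega) hroot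
      apply h0
      linear_combination this - hwz'

theorem mainTheorem4 :
    {z : ℂ | IsLimitOfRoots
        (fun n : ℕ+ => (SimpleGraph.friendshipGraph (n : ℕ))ᶜ.dominationPolynomial) z} =
      {z : ℂ | ‖z + 1‖ = 1} :=
  Set.ext fun _ => ⟨norm_eq_one_of_isLimitOfRoots, isLimitOfRoots_of_norm_eq_one⟩
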